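/- **Model.** Let $(\Omega,P)$ be a population of players, with positive weights $W$ of finite mean. Let $P_{\mathrm{go}}\in(0,1]$. On every day $t=0,1,2,\dots$ each player participates with probability $P_{\mathrm{go}}$ and has a random urgency $U_t\ge 0$ whose law has a continuous c.d.f. and finite mean $\mathbb E[U]$, the same law every day. The weight, the initial currency level $K_0$, the daily participations and the daily urgencies are mutually independent. The decision on day $t$ is $A_t\in\{0,1,2\}$, with $A_t=0$ exactly for the players that do not participate. The aggregate is $w^{A_t}=(w_1^{A_t},w_2^{A_t})$, where $w_r^{A_t}=\mathbb E[W\mathbf 1_{A_t=r}]/\mathbb E[W]$. The latencies $l_1,l_2$ are continuous and nondecreasing on $[0,P_{\mathrm{go}}]$. For prices $p=(p_1,p_2)$ the currency level evolves as $K_{t+1}=K_t-p_{A_t}$, with $p_0:=0$. Given the aggregate $w$, a participating player with level $k$ and urgency $u$ chooses $r\in\{1,2\}$ (today's strategy) and $y\in[0,1]$ (planned fraction of strategy $1$ in the $P_{\mathrm{go}}T$ expected participations of the next $T$ days) so as to minimize $$u\,l_r(w_r)+\mathbb E[U]\,P_{\mathrm{go}}T\,\bigl(y\,l_1(w_1)+(1-y)\,l_2(w_2)\bigr)$$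 subject to $k-p_r\ge 0$ and $k-p_r-P_{\mathrm{go}}T\,(y\,p_1+(1-y)\,p_2)\ge 0$. A measurable $A_t$ is a Nash equilibrium of day $t$ if almost every participating player plays such an optimal $r$ against $w=w^{A_t}$ (with $k=K_t$, $u=U_t$). An *equilibrium path* is a sequence $(A_t)$ of Nash equilibria such that, on every day that admits a Nash equilibrium with $l_1(w_1)<l_2(w_2)$, the equilibrium $A_t$ is of that kind. Let $C$ be a social cost that is a function of the aggregate, let $w^\star$ minimize $C$ over $\{w\ge 0,\ w_1+w_2=P_{\mathrm{go}}\}$, and suppose that $w^\star_1,w^\star_2>0$, $l_1(w_1^\star)<l_2(w_2^\star)$, $C(w^\star)>0$, and that $C$ is Lipschitz on this set with constant $L_C$ with respect to the maximum norm. Put $\mathrm{PoA}_t=C(w^{A_t})/C(w^\star)$. Let $N_t$ and $N_t^1$ be the number of participations of a player, and of her choices of strategy $1$, before day $t$. Let the average perceived latency be $$L_t=l_1(w_1^{A_t})\frac{N_t^1}{N_t}+\Bigl(1-\frac{N_t^1}{N_t}\Bigr)l_2(w_2^{A_t})$$ and let $L'_t=\frac1{N_t}\sum_{s<t,\,A_s\ne0}l_{A_s}(w^{A_s}_{A_s})$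 be the average of the latencies that the player met before day $t$ (with $0/0:=0$ for players who have not participated yet). For $\delta>0$ let $\mathrm{rat}_\delta(x)=q_j$ for $x\in((j-1)\delta,j\delta]$, $j\ge1$, where the $q_j$ are any positive rationals with $|q_j-x|<\delta$ for all $x\in((j-1)\delta,j\delta]$. **Theorem.** There is $\delta_0>0$ such that the following holds for all $\delta\in(0,\delta_0)$, every choice of $\mathrm{rat}_\delta$, every scale $S>0$ and the weight-independent prices $\bar p=S\,[\mathrm{rat}_\delta(w_2^\star/w_1^\star),\,-1]^\top$ (which are rational if $S$ is). There is a probability distribution on $[0,\infty)$ such that, if $K_0$ has this distribution, then an equilibrium path exists, and for every equilibrium path: 1. $K_t$ converges in distribution as $t\to\infty$; 2. $\lim_{t\to\infty}\mathrm{PoA}_t$ exists and is at most $1+\varepsilon$, where $$\varepsilon=\frac{L_C}{C(w^\star)}\cdot\frac{\delta\,w_1^\star}{P_{\mathrm{go}}/w_1^\star-\delta}=O(\delta);$$ 3. the temporal inequity vanishes in the limit: $L_t$ and $L'_t$ are square integrable, $\sqrt{\mathrm{Var}[L_t]}\to0$, and also $\sqrt{\mathrm{Var}[L'_t]}\to0$.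 -/

import Mathlib

open MeasureTheory ProbabilityTheory Filter Topology Set
open scoped NNReal

namespace ACGame

/-- The data of a repeated weighted congestion game with two strategies `1`, `2`:
participation probability, planning horizon, latencies, social cost (a function of the pair of
weight proportions on the two strategies), law of the daily urgency, law of the weights. -/
structure Game where
  Pgo : ℝ
  Pgo_pos : 0 < Pgo
  Pgo_le_one : Pgo ≤ 1
  /-- number of future days a player plans ahead for -/
  T : ℕ
  l₁ : ℝ → ℝ
  l₂ : ℝ → ℝ
  continuousOn_l₁ : ContinuousOn l₁ (Icc 0 Pgo)
  continuousOn_l₂ : ContinuousOn l₂ (Icc 0 Pgo)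
  monotoneOn_l₁ : MonotoneOn l₁ (Icc 0 Pgo)
  monotoneOn_l₂ : MonotoneOn l₂ (Icc 0 Pgo)
  C : ℝ × ℝ → ℝ
  urgencyLaw : Measure ℝ
  isProbabilityMeasure_urgencyLaw : IsProbabilityMeasure urgencyLaw
  /-- the c.d.f. of the urgency is continuous -/
  nullSingletonClass_urgencyLaw : NullSingletonClass urgencyLaw
  urgency_nonneg : ∀ᵐ u ∂urgencyLaw, 0 ≤ u
  integrable_urgency : Integrable (fun u : ℝ => u) urgencyLaw
  weightLaw : Measure ℝ
  isProbabilityMeasure_weightLaw : IsProbabilityMeasure weightLaw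
  weight_pos : ∀ᵐ w ∂weightLaw, 0 < w
  integrable_weight : Integrable (fun w : ℝ => w) weightLaw

/-- Aggregate weight proportions that can occur: nonnegative pairs with sum `Pgo`. -/
def Game.feasible (G : Game) : Set (ℝ × ℝ) :=
  {w | 0 ≤ w.1 ∧ 0 ≤ w.2 ∧ w.1 + w.2 = G.Pgo}

/-- `w` minimizes the social cost over all feasible aggregates. -/
def Game.IsSystemOptimum (G : Game) (w : ℝ × ℝ) : Prop :=
  w ∈ G.feasible ∧ ∀ v ∈ G.feasible, G.C w ≤ G.C v

/-- Expected urgency. -/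
noncomputable def Game.meanUrgency (G : Game) : ℝ := ∫ u, u ∂G.urgencyLaw

/-- Latency of a decision in `{0, 1, 2}` under the aggregate `w`; decision `0` means that the
player does not participate. -/
def Game.latency (G : Game) (w : ℝ × ℝ) : Fin 3 → ℝ := ![0, G.l₁ w.1, G.l₂ w.2]

/-- Payment for a decision in `{0, 1, 2}` under the prices `p`. -/
def payment (p : ℝ × ℝ) : Fin 3 → ℝ := ![0, p.1, p.2]

/-- Plans `(r, y)` open to a participating player with currency level `k`: a strategy
`r ∈ {1, 2}` for today and a fraction `y ∈ [0, 1]` of the `Pgo * T` expected future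
participations in which strategy `1` will be used, such that the currency level is nonnegative
after today's payment and at the end of the horizon. -/
def Game.plans (G : Game) (p : ℝ × ℝ) (k : ℝ) : Set (Fin 3 × ℝ) :=
  {x | x.1 ≠ 0 ∧ x.2 ∈ Icc (0 : ℝ) 1 ∧ 0 ≤ k - payment p x.1 ∧
    0 ≤ k - payment p x.1 - G.Pgo * G.T * (x.2 * p.1 + (1 - x.2) * p.2)}

/-- Perceived cost of a plan under the aggregate `w` for a player whose urgency today is `u`. -/
noncomputable def Game.planCost (G : Game) (w : ℝ × ℝ) (u : ℝ) (x : Fin 3 × ℝ) : ℝ :=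
  u * G.latency w x.1 +
    G.meanUrgency * (G.Pgo * G.T * (x.2 * G.l₁ w.1 + (1 - x.2) * G.l₂ w.2))

/-- `r` is today's decision of a plan of least perceived cost. -/
def Game.IsBestResponse (G : Game) (p w : ℝ × ℝ) (k u : ℝ) (r : Fin 3) : Prop :=
  ∃ y : ℝ, (r, y) ∈ G.plans p k ∧ IsMinOn (G.planCost w u) (G.plans p k) (r, y)

/-- The population `(Ω, P)` of players with its weights `W`, initial currency levels `K₀` of
law `μ₀`, daily participations and daily urgencies. All of these random variables are mutually
independent (this is the meaning of the last four fields taken together). -/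
structure Population (G : Game) (μ₀ : Measure ℝ) {Ω : Type*} [MeasurableSpace Ω]
    (P : Measure Ω) where
  W : Ω → ℝ
  K₀ : Ω → ℝ
  participates : ℕ → Ω → Bool
  U : ℕ → Ω → ℝ
  measurable_W : Measurable W
  measurable_K₀ : Measurable K₀
  measurable_participates : ∀ t, Measurable (participates t)
  measurable_U : ∀ t, Measurable (U t)
  law_W : P.map W = G.weightLaw
  law_K₀ : P.map K₀ = μ₀
  law_participates : ∀ t, P.real {ω | participates t ω = true} = G.Pgo
  law_U : ∀ t, P.map (U t) = G.urgencyLaw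
  indep_W_K₀ : IndepFun W K₀ P
  indep_daily : ∀ t, IndepFun (participates t) (U t) P
  indep_days : iIndepFun (fun t ω => (participates t ω, U t ω)) P
  indep_static_days :
    IndepFun (fun ω => (W ω, K₀ ω)) (fun ω (t : ℕ) => (participates t ω, U t ω)) P

section Dynamics

variable {G : Game} {μ₀ : Measure ℝ} {Ω : Type*} [MeasurableSpace Ω] {P : Measure Ω}

/-- Proportion of the total weight of the population carried by the players with decision `r`. -/
noncomputable def Population.load (X : Population G μ₀ P) (a : Ω → Fin 3) (r : Fin 3) : ℝ :=
  (∫ ω in {ω | a ω = r}, X.W ω ∂P) / ∫ ω, X.W ω ∂P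

/-- Aggregate weight proportions on the strategies `1` and `2`. -/
noncomputable def Population.aggregate (X : Population G μ₀ P) (a : Ω → Fin 3) : ℝ × ℝ :=
  (X.load a 1, X.load a 2)

/-- Currency level before day `t`, when the decisions on day `s` are `A s`. -/
noncomputable def Population.level (X : Population G μ₀ P) (p : ℝ × ℝ) (A : ℕ → Ω → Fin 3) :
    ℕ → Ω → ℝ
  | 0 => X.K₀
  | t + 1 => fun ω => X.level p A t ω - payment p (A t ω)

/-- `a` is a Nash equilibrium of day `t` when the currency levels are `K`: (almost) every
participating player best-responds to the aggregate, on which a single player has no influence. -/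
structure Population.IsNash (X : Population G μ₀ P) (p : ℝ × ℝ) (t : ℕ) (K : Ω → ℝ)
    (a : Ω → Fin 3) : Prop where
  measurable : Measurable a
  absent : ∀ᵐ ω ∂P, X.participates t ω = false → a ω = 0
  bestResponse : ∀ᵐ ω ∂P, X.participates t ω = true →
    G.IsBestResponse p (X.aggregate a) (K ω) (X.U t ω) (a ω)

/-- Strategy `1` is strictly faster than strategy `2` under the decisions `a`. -/
def Population.FirstFaster (X : Population G μ₀ P) (a : Ω → Fin 3) : Prop :=
  G.l₁ (X.aggregate a).1 < G.l₂ (X.aggregate a).2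

/-- A sequence of decisions that form a Nash equilibrium every day. Days may have several
equilibria, in some of which both latencies coincide and players are indifferent;
an equilibrium with `l₁ < l₂` (it is essentially unique) is the one played if there is one. -/
structure Population.IsEquilibriumPath (X : Population G μ₀ P) (p : ℝ × ℝ)
    (A : ℕ → Ω → Fin 3) : Prop where
  isNash : ∀ t, X.IsNash p t (X.level p A t) (A t)
  selection : ∀ t, (∃ a, X.IsNash p t (X.level p A t) a ∧ X.FirstFaster a) →
    X.FirstFaster (A t)

/-- Number of participations of a player before day `t`. -/
def participations (A : ℕ → Ω → Fin 3) (t : ℕ) (ω : Ω) : ℕ :=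
  ((Finset.range t).filter (fun s => A s ω ≠ 0)).card

/-- Number of times that a player has chosen strategy `1` before day `t`. -/
def firstChoices (A : ℕ → Ω → Fin 3) (t : ℕ) (ω : Ω) : ℕ :=
  ((Finset.range t).filter (fun s => A s ω = 1)).card

/-- Average perceived latency of a player, at the latencies of day `t`. -/
noncomputable def Population.avgLatency (X : Population G μ₀ P) (A : ℕ → Ω → Fin 3)
    (t : ℕ) (ω : Ω) : ℝ :=
  G.l₁ (X.aggregate (A t)).1 * ((firstChoices A t ω : ℝ) / participations A t ω) +
    (1 - (firstChoices A t ω : ℝ) / participations A t ω) * G.l₂ (X.aggregate (A t)).2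

/-- Average over a player's participations before day `t` of the latencies met on those days. -/
noncomputable def Population.timeAvgLatency (X : Population G μ₀ P) (A : ℕ → Ω → Fin 3)
    (t : ℕ) (ω : Ω) : ℝ :=
  (∑ s ∈ Finset.range t, G.latency (X.aggregate (A s)) (A s ω)) / participations A t ω

/-- Price of anarchy on day `t`, relative to the system optimum `wopt`. -/
noncomputable def Population.priceOfAnarchy (X : Population G μ₀ P) (wopt : ℝ × ℝ)
    (A : ℕ → Ω → Fin 3) (t : ℕ) : ℝ :=
  G.C (X.aggregate (A t)) / G.C wopt

end Dynamics

/-- The interval `(jδ, (j+1)δ]`. -/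
def bracket (δ : ℝ) (j : ℕ) : Set ℝ := Ioc (j * δ) ((j + 1) * δ)

/-- Positive rationals, the `j`-th one closer than `δ` to every point of the `j`-th bracket. -/
def IsRationalFamily (δ : ℝ) (q : ℕ → ℚ) : Prop :=
  ∀ j, 0 < q j ∧ ∀ x ∈ bracket δ j, |(q j : ℝ) - x| < δ

/-- The rational approximation function that takes the value `q j` on the `j`-th bracket. -/
noncomputable def rat (δ : ℝ) (q : ℕ → ℚ) (x : ℝ) : ℝ :=
  ∑' j : ℕ, (bracket δ j).indicator (fun _ => (q j : ℝ)) x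

end ACGame

/-!
The trick is to let `K₀` have a stationary law, so that nothing changes over time except the
histories of single players.

Suppose that `l₁ < l₂` under today's aggregate. Postponing a use of strategy `1` trades urgency
today for the expected urgency later, so a player prefers strategy `1` exactly if she can afford it
and her urgency is at least a threshold that depends on her level alone
(`Game.isBestResponse_one_iff`, `Game.isBestResponse_two_iff`). The aggregate does not enter; hence
under this threshold rule the levels form a Markov chain. For a rational price ratio `q` and a
suitable initial level it lives on a finite part of a lattice: poor players cannot afford
strategy `1` and rich players always choose it. So it has a stationary law `μ₀`
(`Game.exists_isStationary`). Only existence is needed, not uniqueness or ergodicity.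

If `K₀` has the law `μ₀`, then the mean payment is `0` every day, so strategy `2` is chosen `q` times
as often as strategy `1`. As the weights are independent of the decisions, the loads are
`G.Pgo / (1 + q)` and `G.Pgo * q / (1 + q)` (`Population.aggregate_ruleDecision`). For `q` close to
`wopt.2 / wopt.1` they are close to `wopt`, so `l₁ < l₂` holds and the threshold rule is an
equilibrium. Conversely, the selection of equilibria with `l₁ < l₂` forces every equilibrium path to
follow the rule almost surely: ties have probability `0`, because the urgency has no atoms
(`Population.IsEquilibriumPath.level_ae_eq`). Thus the law of the level and the price of anarchy are
constant in time, and the Lipschitz bound gives `Game.IsSystemOptimum.cost_ratio_le`.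

The temporal inequity vanishes because levels are bounded: the level determines the payments made
so far, so a player's share of choices of strategy `1` differs from `1 / (1 + q)` by a constant over
the number of her participations, which tends to infinity by Borel-Cantelli
(`Population.IsEquilibriumPath.ae_tendsto_ratio`). Dominated convergence turns this into variances.
-/

namespace ACGame

section

/-! ### Invariant laws of finite Markov chains -/

/-- A stochastic matrix has a stationary probability vector. The entrywise absolute value of a left
eigenvector `y` for the eigenvalue `1` is again fixed: `|y| ≤ |y| M` entrywise by the triangle
inequality, and both sides have the same total mass. -/
theorem exists_stationary_vector {n : Type*} [Fintype n] [DecidableEq n] [Nonempty n]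
    {M : Matrix n n ℝ} (hM : ∀ i j, 0 ≤ M i j) (hsum : ∀ i, ∑ j, M i j = 1) :
    ∃ x : n → ℝ, (∀ i, 0 ≤ x i) ∧ ∑ i, x i = 1 ∧ ∀ j, ∑ i, x i * M i j = x j := by
  have hdet : (M - 1).det = 0 := by
    rw [← Matrix.exists_mulVec_eq_zero_iff]
    refine ⟨fun _ => 1, fun h => one_ne_zero (congrFun h (Classical.arbitrary n)), ?_⟩
    rw [Matrix.sub_mulVec, Matrix.one_mulVec]
    ext i
    simp [Matrix.mulVec, dotProduct, hsum]
  obtain ⟨y, hy0, hy⟩ := Matrix.exists_vecMul_eq_zero_iff.mpr hdet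
  have hfix : ∀ j, ∑ i, y i * M i j = y j := by
    intro j
    have := congrFun hy j
    rw [Matrix.vecMul_sub, Matrix.vecMul_one] at this
    simpa [Matrix.vecMul, dotProduct, sub_eq_zero] using this
  have hle : ∀ j ∈ Finset.univ, |y j| ≤ ∑ i, |y i| * M i j := by
    intro j _
    calc |y j| = |∑ i, y i * M i j| := by rw [hfix]
      _ ≤ ∑ i, |y i * M i j| := Finset.abs_sum_le_sum_abs _ _
      _ = ∑ i, |y i| * M i j := by simp_rw [abs_mul, abs_of_nonneg (hM _ _)]
  have htot : ∑ j, |y j| = ∑ j, ∑ i, |y i| * M i j := by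
    rw [Finset.sum_comm]
    simp_rw [← Finset.mul_sum, hsum, mul_one]
  have heq := (Finset.sum_eq_sum_iff_of_le hle).1 htot
  obtain ⟨i₀, hi₀⟩ := Function.ne_iff.1 hy0
  have hpos : 0 < ∑ i, |y i| :=
    Finset.sum_pos' (fun i _ => abs_nonneg _) ⟨i₀, Finset.mem_univ _, abs_pos.2 hi₀⟩
  refine ⟨fun i => |y i| / ∑ i, |y i|, fun i => by positivity, ?_, fun j => ?_⟩
  · rw [← Finset.sum_div, div_self hpos.ne']
  · simp_rw [div_mul_eq_mul_div]
    rw [← Finset.sum_div, ← heq j (Finset.mem_univ j)]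

/-- A random dynamical system driven by noise of law `ν` has an invariant law on every nonempty
finite set that it preserves. -/
theorem exists_invariant_measure {α D : Type*} [MeasurableSpace α] [MeasurableSingletonClass α]
    [MeasurableSpace D] (ν : Measure D) [IsProbabilityMeasure ν] {F : α × D → α}
    (hF : Measurable F) {E : Finset α} (hE : E.Nonempty)
    (hinv : ∀ k ∈ E, ∀ d, F (k, d) ∈ E) :
    ∃ μ : Measure α, IsProbabilityMeasure μ ∧ (∀ᵐ k ∂μ, k ∈ E) ∧ (μ.prod ν).map F = μ := by
  classical
  have : Nonempty E := hE.to_subtype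
  have hms : ∀ (k : α) (s : Set α), MeasurableSet s → MeasurableSet {d | F (k, d) ∈ s} :=
    fun k s hs => (hF.comp measurable_prodMk_left) hs
  obtain ⟨x, hx0, hx1, hx⟩ := exists_stationary_vector
    (M := fun i j : E => ν.real {d | F (i, d) = j}) (fun _ _ => measureReal_nonneg) (by
      intro i
      rw [← measureReal_biUnion_finset]
      · rw [← probReal_univ (μ := ν)]
        congr 1
        ext d
        simpa using hinv i i.2 d
      · intro j _ j' _ hjj
        refine Set.disjoint_left.2 fun d hd hd' => hjj (Subtype.ext ?_)
        exact (show F (i, d) = j from hd).symm.trans hd'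
      · intro j _
        exact hms i {(j : α)} (measurableSet_singleton _))
  set μ : Measure α := ∑ i : E, ENNReal.ofReal (x i) • Measure.dirac (i : α) with hμ
  have hμs : ∀ s, MeasurableSet s → μ s = ∑ i : E, ENNReal.ofReal (x i) * s.indicator 1 (i : α) := by
    intro s hs
    simp [hμ, Measure.finsetSum_apply, Measure.dirac_apply' _ hs]
  have hprob : IsProbabilityMeasure μ := ⟨by
    rw [hμs _ MeasurableSet.univ]
    simp only [indicator_univ, Pi.one_apply, mul_one]
    rw [← ENNReal.ofReal_sum_of_nonneg (fun i _ => hx0 i), hx1, ENNReal.ofReal_one]⟩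
  refine ⟨μ, hprob, ?_, ?_⟩
  · rw [ae_iff, show {a | ¬ a ∈ E} = (E : Set α)ᶜ from rfl, hμs _ E.measurableSet.compl]
    simp
  · ext s hs
    rw [Measure.map_apply hF hs, Measure.prod_apply (hF hs), hμs s hs, hμ,
      lintegral_finsetSum_measure]
    simp_rw [lintegral_smul_measure]
    have hν : ∀ i : E, ν (Prod.mk (i : α) ⁻¹' (F ⁻¹' s)) =
        ∑ j : E, ν {d | F (i, d) = j} * s.indicator 1 (j : α) := by
      intro i
      have : Prod.mk (i : α) ⁻¹' (F ⁻¹' s) =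
          ⋃ j ∈ Finset.univ.filter (fun j : E => (j : α) ∈ s), {d | F (i, d) = j} := by
        ext d
        simp only [mem_preimage, Finset.mem_filter, Finset.mem_univ, true_and, mem_iUnion,
          mem_ofPred_eq, exists_prop]
        constructor
        · intro h
          exact ⟨⟨_, hinv i i.2 d⟩, h, rfl⟩
        · rintro ⟨j, hj, h⟩
          rwa [h]
      rw [this, measure_biUnion_finset]
      · rw [Finset.sum_filter]
        refine Finset.sum_congr rfl fun j _ => ?_
        by_cases h : (j : α) ∈ s <;> simp [h]
      · intro j _ j' _ hjj
        refine Set.disjoint_left.2 fun d hd hd' => hjj (Subtype.ext ?_)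
        exact (show F (i, d) = j from hd).symm.trans hd'
      · intro j _
        exact hms i {(j : α)} (measurableSet_singleton _)
    have hmeas : Measurable fun k => ν (Prod.mk k ⁻¹' (F ⁻¹' s)) :=
      measurable_measure_prodMk_left (hF hs)
    simp_rw [lintegral_dirac' _ hmeas, hν, smul_eq_mul, Finset.mul_sum]
    rw [Finset.sum_comm]
    refine Finset.sum_congr rfl fun j _ => ?_
    simp_rw [← mul_assoc]
    rw [← Finset.sum_mul, ← hx j, ENNReal.ofReal_sum_of_nonneg
      (fun i _ => mul_nonneg (hx0 i) measureReal_nonneg)]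
    congr 1
    refine Finset.sum_congr rfl fun i _ => ?_
    rw [ENNReal.ofReal_mul (hx0 i), ofReal_measureReal]

/-! ### Independence -/

/-- If `X` is independent of `(Y, Z)` and `Y` of `Z`, then `X`, `Y`, `Z` are mutually
independent, hence `(X, Y)` is independent of `Z`. -/
theorem indepFun_prodMk_of_indepFun {Ω α β γ : Type*} [MeasurableSpace Ω] [MeasurableSpace α]
    [MeasurableSpace β] [MeasurableSpace γ] {P : Measure Ω} [IsProbabilityMeasure P]
    {X : Ω → α} {Y : Ω → β} {Z : Ω → γ} (hX : Measurable X) (hY : Measurable Y)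
    (hZ : Measurable Z) (h : IndepFun X (fun ω => (Y ω, Z ω)) P) (h' : IndepFun Y Z P) :
    IndepFun (fun ω => (X ω, Y ω)) Z P := by
  have hXY : IndepFun X Y P := h.comp measurable_id measurable_fst
  have := Measure.isProbabilityMeasure_map (μ := P) hX.aemeasurable
  have := Measure.isProbabilityMeasure_map (μ := P) hY.aemeasurable
  have := Measure.isProbabilityMeasure_map (μ := P) hZ.aemeasurable
  rw [indepFun_iff_map_prod_eq_prod_map_map (by fun_prop) (by fun_prop)] at h h' hXY ⊢
  rw [hXY]
  apply (MeasurableEquiv.prodAssoc (α := α) (β := β) (γ := γ)).map_measurableEquiv_injective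
  rw [Measure.prodAssoc_prod, ← h', ← h, Measure.map_map (by fun_prop) (by fun_prop)]
  rfl

end

section

/-! ### Best responses when the first strategy is faster -/

/-- The most participations with strategy `1` that a player with `c` units of currency after
today's payment can plan for, when strategy `1` costs `S * q`, strategy `2` earns `S`, and `N`
participations are expected over the horizon. -/
noncomputable def maxUses (q S N c : ℝ) : ℝ := min N ((c / S + N) / (q + 1))

/-- The urgency from which on a player with level `k` prefers strategy `1` today, when it costs
`S * q` and strategy `2` earns `S`: the expected urgency times the number of planned uses of
strategy `1` that today's use crowds out. -/
noncomputable def Game.threshold (G : Game) (q S k : ℝ) : ℝ :=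
  G.meanUrgency * (maxUses q S (G.Pgo * G.T) (k + S) - maxUses q S (G.Pgo * G.T) (k - S * q))

variable {G : Game} {q S k u : ℝ} {w : ℝ × ℝ}

theorem Game.horizon_nonneg (G : Game) : 0 ≤ G.Pgo * G.T :=
  mul_nonneg G.Pgo_pos.le (Nat.cast_nonneg _)

theorem Game.meanUrgency_pos (G : Game) : 0 < G.meanUrgency := by
  have := G.isProbabilityMeasure_urgencyLaw
  have := G.nullSingletonClass_urgencyLaw
  refine (integral_pos_iff_support_of_nonneg_ae G.urgency_nonneg G.integrable_urgency).2 ?_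
  have : G.urgencyLaw (Function.support fun u : ℝ => u) = 1 := by
    rw [show (Function.support fun u : ℝ => u) = {(0 : ℝ)}ᶜ by ext; simp,
      prob_compl_eq_one_iff (measurableSet_singleton _)]
    exact measure_singleton _
  simp [this]

theorem maxUses_eq_of_le {N c : ℝ} (hq : 0 < q) (hS : 0 < S) (h : N * q * S ≤ c) :
    maxUses q S N c = N := by
  refine min_eq_left ?_
  rw [le_div_iff₀ (by linarith)]
  have : N * q ≤ c / S := by rwa [le_div_iff₀ hS]
  linarith

theorem maxUses_nonneg {N c : ℝ} (hq : 0 < q) (hS : 0 < S) (hN : 0 ≤ N) (hc : 0 ≤ c) :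
    0 ≤ maxUses q S N c := by
  unfold maxUses
  positivity

theorem Game.threshold_eq_zero (hq : 0 < q) (hS : 0 < S) (hk : (G.Pgo * G.T + 1) * q * S ≤ k) :
    G.threshold q S k = 0 := by
  have := mul_pos hq hS
  rw [Game.threshold, maxUses_eq_of_le hq hS (by linarith), maxUses_eq_of_le hq hS (by linarith),
    sub_self, mul_zero]

theorem Game.continuous_threshold (G : Game) (q S : ℝ) : Continuous (G.threshold q S) := by
  unfold Game.threshold maxUses
  fun_prop

/-- The plan for the future enters the perceived cost through the planned number of uses of
strategy `1`, each of which saves `l₂ - l₁` times the expected urgency. -/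
theorem Game.planCost_eq (G : Game) (w : ℝ × ℝ) (u : ℝ) (r : Fin 3) (y : ℝ) :
    G.planCost w u (r, y) = u * G.latency w r + G.meanUrgency * (G.Pgo * G.T * G.l₂ w.2
      - G.Pgo * G.T * y * (G.l₂ w.2 - G.l₁ w.1)) := by
  simp only [Game.planCost]
  ring

theorem Game.uses_le_of_mem_plans (hq : 0 < q) (hS : 0 < S) {r : Fin 3} {y : ℝ}
    (h : (r, y) ∈ G.plans (S * q, -S) k) :
    G.Pgo * G.T * y ≤ maxUses q S (G.Pgo * G.T) (k - payment (S * q, -S) r) := by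
  obtain ⟨-, ⟨hy0, hy1⟩, -, h⟩ := h
  have := G.horizon_nonneg
  simp only at hy0 hy1 h
  refine le_min (mul_le_of_le_one_right this hy1) ?_
  rw [le_div_iff₀ (by linarith), ← sub_le_iff_le_add, le_div_iff₀ hS]
  linarith

theorem Game.exists_mem_plans (hq : 0 < q) (hS : 0 < S) {r : Fin 3} (hr : r ≠ 0)
    (h : 0 ≤ k - payment (S * q, -S) r) :
    ∃ y, (r, y) ∈ G.plans (S * q, -S) k ∧
      G.Pgo * G.T * y = maxUses q S (G.Pgo * G.T) (k - payment (S * q, -S) r) := by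
  have hN := G.horizon_nonneg
  have hm := maxUses_nonneg hq hS hN h
  set c := k - payment (S * q, -S) r
  set N := G.Pgo * G.T
  obtain ⟨y, hy0, hy1, hy⟩ : ∃ y, 0 ≤ y ∧ y ≤ 1 ∧ N * y = maxUses q S N c := by
    rcases hN.eq_or_lt with hN | hN
    · refine ⟨0, le_rfl, zero_le_one, ?_⟩
      rw [mul_zero]
      exact le_antisymm hm (hN ▸ min_le_left _ _)
    · exact ⟨maxUses q S N c / N, by positivity, (div_le_one hN).2 (min_le_left _ _),
        mul_div_cancel₀ _ hN.ne'⟩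
  refine ⟨y, ⟨hr, ⟨hy0, hy1⟩, h, ?_⟩, hy⟩
  have h2 : N * y ≤ (c / S + N) / (q + 1) := hy ▸ min_le_right _ _
  rw [le_div_iff₀ (by linarith), ← sub_le_iff_le_add, le_div_iff₀ hS] at h2
  change 0 ≤ c - N * (y * (S * q) + (1 - y) * -S)
  linarith

/-- The least perceived cost of a plan that starts with decision `r`. -/
noncomputable def Game.bestCost (G : Game) (q S k : ℝ) (w : ℝ × ℝ) (u : ℝ) (r : Fin 3) : ℝ :=
  u * G.latency w r + G.meanUrgency * (G.Pgo * G.T * G.l₂ w.2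
    - maxUses q S (G.Pgo * G.T) (k - payment (S * q, -S) r) * (G.l₂ w.2 - G.l₁ w.1))

/-- Once future uses of strategy `1` are planned optimally, a best response is a minimizer of
`bestCost` among the affordable decisions. -/
theorem Game.isBestResponse_iff (hq : 0 < q) (hS : 0 < S) (hw : G.l₁ w.1 < G.l₂ w.2)
    (r : Fin 3) : G.IsBestResponse (S * q, -S) w k u r ↔
      (r ≠ 0 ∧ 0 ≤ k - payment (S * q, -S) r) ∧
        ∀ s : Fin 3, s ≠ 0 → 0 ≤ k - payment (S * q, -S) s →
          G.bestCost q S k w u r ≤ G.bestCost q S k w u s := by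
  have hE := G.meanUrgency_pos
  have hle : ∀ s y, (s, y) ∈ G.plans (S * q, -S) k →
      G.bestCost q S k w u s ≤ G.planCost w u (s, y) := by
    intro s y h
    rw [G.planCost_eq, Game.bestCost]
    have := Game.uses_le_of_mem_plans hq hS h
    have hd : 0 ≤ G.l₂ w.2 - G.l₁ w.1 := by linarith
    gcongr
  have hex : ∀ s, s ≠ 0 → 0 ≤ k - payment (S * q, -S) s → ∃ y,
      (s, y) ∈ G.plans (S * q, -S) k ∧ G.planCost w u (s, y) = G.bestCost q S k w u s := by
    intro s hs h
    obtain ⟨y, hy, he⟩ := Game.exists_mem_plans (G := G) hq hS hs h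
    exact ⟨y, hy, by rw [G.planCost_eq, Game.bestCost, he]⟩
  constructor
  · rintro ⟨y, hy, hmin⟩
    refine ⟨⟨hy.1, hy.2.2.1⟩, fun s hs h => ?_⟩
    obtain ⟨z, hz, he⟩ := hex s hs h
    exact (hle r y hy).trans ((hmin hz).trans he.le)
  · rintro ⟨⟨hr, h⟩, hmin⟩
    obtain ⟨y, hy, he⟩ := hex r hr h
    refine ⟨y, hy, ?_⟩
    rintro ⟨s, z⟩ hz
    exact he.le.trans ((hmin s hz.1 hz.2.2.1).trans (hle s z hz))

theorem Game.bestCost_one_sub_two (G : Game) (q S k u : ℝ) (w : ℝ × ℝ) :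
    G.bestCost q S k w u 2 - G.bestCost q S k w u 1 =
      (G.l₂ w.2 - G.l₁ w.1) * (u - G.threshold q S k) := by
  simp only [Game.bestCost, Game.threshold, Game.latency, payment, Matrix.cons_val, sub_neg_eq_add]
  ring

theorem Game.isBestResponse_one_iff (hq : 0 < q) (hS : 0 < S) (hk : 0 ≤ k)
    (hw : G.l₁ w.1 < G.l₂ w.2) : G.IsBestResponse (S * q, -S) w k u 1 ↔
      S * q ≤ k ∧ G.threshold q S k ≤ u := by
  have h := G.bestCost_one_sub_two q S k u w
  have hiff : G.bestCost q S k w u 1 ≤ G.bestCost q S k w u 2 ↔ G.threshold q S k ≤ u := by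
    rw [← sub_nonneg, h, mul_nonneg_iff_of_pos_left (by linarith), sub_nonneg]
  rw [Game.isBestResponse_iff hq hS hw, ← hiff]
  simp only [Fin.forall_fin_succ, payment]
  simp
  grind

theorem Game.isBestResponse_two_iff (hq : 0 < q) (hS : 0 < S) (hk : 0 ≤ k)
    (hw : G.l₁ w.1 < G.l₂ w.2) : G.IsBestResponse (S * q, -S) w k u 2 ↔
      (S * q ≤ k → u ≤ G.threshold q S k) := by
  have h := G.bestCost_one_sub_two q S k u w
  have hiff : G.bestCost q S k w u 2 ≤ G.bestCost q S k w u 1 ↔ u ≤ G.threshold q S k := by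
    rw [← sub_nonpos, h, ← neg_nonneg, ← mul_neg, mul_nonneg_iff_of_pos_left (by linarith),
      neg_nonneg, sub_nonpos]
  rw [Game.isBestResponse_iff hq hS hw, ← hiff]
  simp only [Fin.forall_fin_succ, payment]
  simp
  grind

theorem Game.IsBestResponse.ne_zero {p : ℝ × ℝ} {r : Fin 3} (h : G.IsBestResponse p w k u r) :
    r ≠ 0 := by
  obtain ⟨y, hy, -⟩ := h
  exact hy.1

end

section

/-! ### The threshold rule and its stationary law -/

variable {G : Game} {q S : ℝ}

/-- The decision of a player with level `k` on a day `d = (participates, urgency)` in an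
equilibrium with `l₁ < l₂`. Negative urgencies, which have probability `0`, are read as `0`, so that
a player whose threshold vanishes always plays `1` and levels stay bounded surely. -/
noncomputable def Game.rule (G : Game) (q S k : ℝ) (d : Bool × ℝ) : Fin 3 :=
  if d.1 = false then 0 else if S * q ≤ k ∧ G.threshold q S k ≤ max d.2 0 then 1 else 2

/-- The level after a day `x.2` that starts at level `x.1`, under the threshold rule. -/
noncomputable def Game.nextLevel (G : Game) (q S : ℝ) (x : ℝ × (Bool × ℝ)) : ℝ :=
  x.1 - payment (S * q, -S) (G.rule q S x.1 x.2)

/-- The joint law of participation and urgency on a single day. -/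
noncomputable def Game.dayLaw (G : Game) : Measure (Bool × ℝ) :=
  (ENNReal.ofReal G.Pgo • Measure.dirac true +
    ENNReal.ofReal (1 - G.Pgo) • Measure.dirac false).prod G.urgencyLaw

/-- `μ₀` is carried by finitely many nonnegative levels and is preserved by one day under the
threshold rule. -/
structure Game.IsStationary (G : Game) (q S : ℝ) (μ₀ : Measure ℝ) : Prop where
  support : ∃ E : Finset ℝ, (∀ k ∈ E, 0 ≤ k) ∧ ∀ᵐ k ∂μ₀, k ∈ E
  invariant : (μ₀.prod G.dayLaw).map (G.nextLevel q S) = μ₀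

theorem Game.rule_eq_zero_iff {k : ℝ} {d : Bool × ℝ} : G.rule q S k d = 0 ↔ d.1 = false := by
  unfold Game.rule
  split_ifs <;> simp_all

theorem Game.rule_of_nonneg {k u : ℝ} (hu : 0 ≤ u) : G.rule q S k (true, u) =
    if S * q ≤ k ∧ G.threshold q S k ≤ u then 1 else 2 := by
  unfold Game.rule
  rw [if_neg (by simp), max_eq_left hu]

theorem Game.isProbabilityMeasure_participation (G : Game) :
    IsProbabilityMeasure (ENNReal.ofReal G.Pgo • Measure.dirac true +
      ENNReal.ofReal (1 - G.Pgo) • Measure.dirac false) := by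
  refine ⟨?_⟩
  have := G.Pgo_pos.le
  have := G.Pgo_le_one
  simp only [Measure.coe_add, Measure.coe_smul, Pi.add_apply, Pi.smul_apply, measure_univ,
    smul_eq_mul, mul_one]
  rw [← ENNReal.ofReal_add (by linarith) (by linarith)]
  simp

instance Game.isProbabilityMeasure_dayLaw (G : Game) : IsProbabilityMeasure G.dayLaw := by
  have := G.isProbabilityMeasure_urgencyLaw
  have := G.isProbabilityMeasure_participation
  unfold Game.dayLaw
  infer_instance

theorem Game.measurable_rule (G : Game) (q S : ℝ) :
    Measurable fun x : ℝ × (Bool × ℝ) => G.rule q S x.1 x.2 := by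
  have h := (G.continuous_threshold q S).measurable
  unfold Game.rule
  refine Measurable.ite ?_ measurable_const (Measurable.ite ?_ measurable_const measurable_const)
  · exact (measurable_fst.comp measurable_snd) (measurableSet_singleton false)
  · exact (measurableSet_le measurable_const measurable_fst).inter
      (measurableSet_le (h.comp measurable_fst)
        ((measurable_snd.comp measurable_snd).max measurable_const))

theorem measurable_payment (p : ℝ × ℝ) : Measurable (payment p) := measurable_of_countable _

theorem Game.measurable_nextLevel (G : Game) (q S : ℝ) : Measurable (G.nextLevel q S) :=
  measurable_fst.sub ((measurable_payment _).comp (G.measurable_rule q S))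

/-- The threshold rule has a stationary law. For a rational price ratio `q`, the levels
`S * i / q.den` below `S * ((G.Pgo * G.T + 1) * q + 1)` form a finite set that the rule
preserves: strategy `1` is affordable only from level `S * q` on, and strategy `2` is never chosen
from level `S * (G.Pgo * G.T + 1) * q` on, where the threshold vanishes. -/
theorem Game.exists_isStationary (G : Game) (q : ℚ) (hq : 0 < q) (hS : 0 < S) :
    ∃ μ₀ : Measure ℝ, IsProbabilityMeasure μ₀ ∧ G.IsStationary q S μ₀ := by
  have hqR : (0 : ℝ) < q := by exact_mod_cast hq
  have hden : (0 : ℝ) < q.den := by exact_mod_cast q.den_pos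
  have hN := G.horizon_nonneg
  set B : ℝ := (G.Pgo * G.T + 1) * q with hB
  have hB0 : 0 ≤ B := by positivity
  set E : Finset ℝ :=
    (Finset.range ⌈q.den * (B + 1)⌉₊).image fun i : ℕ => S * (i / q.den) with hEdef
  have hmem : ∀ k, k ∈ E ↔ ∃ i : ℕ, k = S * (i / q.den) ∧ k < S * (B + 1) := by
    intro k
    simp only [hEdef, Finset.mem_image, Finset.mem_range, Nat.lt_ceil]
    refine exists_congr fun i => ?_
    rw [and_comm, eq_comm]
    refine and_congr_right fun h => ?_
    rw [h, mul_lt_mul_iff_right₀ hS, div_lt_iff₀ hden, mul_comm]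
  have hne : E.Nonempty := ⟨0, (hmem 0).2 ⟨0, by simp, by positivity⟩⟩
  obtain ⟨μ₀, h1, h2, h3⟩ := exists_invariant_measure G.dayLaw (G.measurable_nextLevel q S) hne (by
    intro k hk d
    obtain ⟨i, hi, hlt⟩ := (hmem k).1 hk
    simp only [Game.nextLevel, Game.rule]
    split_ifs with h0 h1
    · simpa [payment] using hk
    · simp only [payment, Matrix.cons_val]
      have hnum : (q : ℝ) = q.num.toNat / q.den := by
        have : ((q.num.toNat : ℤ) : ℝ) = q.num :=
          congrArg _ (Int.toNat_of_nonneg (Rat.num_pos.2 hq).le)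
        rw [Int.cast_natCast] at this
        rw [this, Rat.cast_def]
      have hle : q.num.toNat ≤ i := by
        have := h1.1
        rw [hi, mul_le_mul_iff_right₀ hS, hnum, div_le_div_iff_of_pos_right hden] at this
        exact_mod_cast this
      refine (hmem _).2 ⟨i - q.num.toNat, ?_, ?_⟩
      · rw [hi, Nat.cast_sub hle]
        conv_lhs => rw [hnum]
        ring
      · linarith [mul_pos hS hqR]
    · simp only [payment, Matrix.cons_val]
      refine (hmem _).2 ⟨i + q.den, ?_, ?_⟩
      · rw [hi]
        push_cast
        field_simp
        ring
      · have : k < S * B := by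
          by_contra! h
          refine h1 ⟨?_, ?_⟩
          · refine le_trans ?_ h
            rw [hB]
            gcongr
            exact le_mul_of_one_le_left hqR.le (by linarith)
          · rw [Game.threshold_eq_zero hqR hS (by linarith)]
            exact le_max_right _ _
        linarith)
  refine ⟨μ₀, h1, ⟨E, fun k hk => ?_, h2⟩, h3⟩
  obtain ⟨i, rfl, -⟩ := (hmem k).1 hk
  positivity

/-! ### The population under the threshold rule -/

variable {μ₀ : Measure ℝ} {Ω : Type*} [MeasurableSpace Ω] {P : Measure Ω}

/-- Participation and urgency on day `t`. -/
def Population.day (X : Population G μ₀ P) (t : ℕ) (ω : Ω) : Bool × ℝ :=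
  (X.participates t ω, X.U t ω)

/-- Levels before day `t` when everybody follows the threshold rule. -/
noncomputable def Population.ruleLevel (X : Population G μ₀ P) (q S : ℝ) : ℕ → Ω → ℝ
  | 0 => X.K₀
  | t + 1 => fun ω => G.nextLevel q S (X.ruleLevel q S t ω, X.day t ω)

/-- Decisions on day `t` when everybody follows the threshold rule. -/
noncomputable def Population.ruleDecision (X : Population G μ₀ P) (q S : ℝ) (t : ℕ) (ω : Ω) :
    Fin 3 :=
  G.rule q S (X.ruleLevel q S t ω) (X.day t ω)

/-- The level before day `t` as a function of the initial level and the sequence of days. -/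
noncomputable def Game.pathLevel (G : Game) (q S : ℝ) : ℕ → ℝ × (ℕ → Bool × ℝ) → ℝ
  | 0 => Prod.fst
  | t + 1 => fun x => G.nextLevel q S (G.pathLevel q S t x, x.2 t)

theorem Game.measurable_pathLevel (G : Game) (q S : ℝ) (t : ℕ) :
    Measurable (G.pathLevel q S t) := by
  induction t with
  | zero => exact measurable_fst
  | succ t ih =>
    exact (G.measurable_nextLevel q S).comp
      (ih.prodMk ((measurable_pi_apply t).comp measurable_snd))

theorem Game.pathLevel_congr (G : Game) (q S k : ℝ) {t : ℕ} {d d' : ℕ → Bool × ℝ}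
    (h : ∀ s < t, d s = d' s) : G.pathLevel q S t (k, d) = G.pathLevel q S t (k, d') := by
  induction t with
  | zero => rfl
  | succ t ih =>
    simp only [Game.pathLevel]
    rw [ih fun s hs => h s (by omega), h t (by omega)]

variable (X : Population G μ₀ P)

theorem Population.level_ruleDecision (t : ℕ) :
    X.level (S * q, -S) (X.ruleDecision q S) t = X.ruleLevel q S t := by
  induction t with
  | zero => rfl
  | succ t ih =>
    funext ω
    simp only [Population.level, ih]
    rfl

theorem Population.ruleLevel_eq_pathLevel (t : ℕ) (ω : Ω) :
    X.ruleLevel q S t ω = G.pathLevel q S t (X.K₀ ω, fun s => X.day s ω) := by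
  induction t with
  | zero => rfl
  | succ t ih =>
    simp only [Population.ruleLevel, Game.pathLevel]
    rw [ih]

theorem Population.measurable_day (t : ℕ) : Measurable (X.day t) :=
  (X.measurable_participates t).prodMk (X.measurable_U t)

theorem Population.measurable_ruleLevel (t : ℕ) : Measurable (X.ruleLevel q S t) := by
  induction t with
  | zero => exact X.measurable_K₀
  | succ t ih => exact (G.measurable_nextLevel q S).comp (ih.prodMk (X.measurable_day t))

theorem Population.measurable_ruleDecision (t : ℕ) : Measurable (X.ruleDecision q S t) :=
  (G.measurable_rule q S).comp ((X.measurable_ruleLevel t).prodMk (X.measurable_day t))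

theorem Population.ae_U_nonneg (t : ℕ) : ∀ᵐ ω ∂P, 0 ≤ X.U t ω := by
  have := G.urgency_nonneg
  rw [← X.law_U t] at this
  exact ae_of_ae_map (X.measurable_U t).aemeasurable this

theorem Population.integral_W_pos : 0 < ∫ ω, X.W ω ∂P := by
  have := G.isProbabilityMeasure_weightLaw
  have h : ∫ ω, X.W ω ∂P = ∫ w, w ∂G.weightLaw := by
    rw [← X.law_W]
    exact (integral_map X.measurable_W.aemeasurable aestronglyMeasurable_id).symm
  have hnn : 0 ≤ᵐ[G.weightLaw] fun w => w := G.weight_pos.mono fun _ h => h.le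
  rw [h]
  refine lt_of_le_of_ne (integral_nonneg_of_ae hnn) fun h0 => ?_
  have h1 := (integral_eq_zero_iff_of_nonneg_ae hnn G.integrable_weight).1 h0.symm
  obtain ⟨w, hw, hw'⟩ := (h1.and G.weight_pos).exists
  exact hw'.ne' hw

variable [IsProbabilityMeasure P]

theorem Population.map_participates (t : ℕ) : P.map (X.participates t) =
    ENNReal.ofReal G.Pgo • Measure.dirac true +
      ENNReal.ofReal (1 - G.Pgo) • Measure.dirac false := by
  have htrue : P {ω | X.participates t ω = true} = ENNReal.ofReal G.Pgo := by
    rw [← X.law_participates t, ofReal_measureReal]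
  refine Measure.ext_of_singleton fun b => ?_
  rw [Measure.map_apply (X.measurable_participates t) (measurableSet_singleton _)]
  cases b
  · have : X.participates t ⁻¹' {false} = {ω | X.participates t ω = true}ᶜ := by
      ext; simp
    have hm : MeasurableSet {ω | X.participates t ω = true} :=
      X.measurable_participates t (measurableSet_singleton true)
    rw [this, prob_compl_eq_one_sub hm,
      htrue, ENNReal.ofReal_sub _ G.Pgo_pos.le]
    simp
  · change P {ω | X.participates t ω = true} = _
    simp [htrue]

theorem Population.map_day (t : ℕ) : P.map (X.day t) = G.dayLaw := by
  have := (indepFun_iff_map_prod_eq_prod_map_map (X.measurable_participates t).aemeasurable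
    (X.measurable_U t).aemeasurable).1 (X.indep_daily t)
  rw [X.map_participates, X.law_U] at this
  exact this

theorem Population.indepFun_W_ruleDecision (t : ℕ) :
    IndepFun X.W (X.ruleDecision q S t) P := by
  have hD : Measurable fun ω (s : ℕ) => X.day s ω := measurable_pi_lambda _ X.measurable_day
  have h : IndepFun X.W (fun ω => (X.K₀ ω, fun s => X.day s ω)) P := by
    have h1 : IndepFun (fun ω (s : ℕ) => X.day s ω) (fun ω => (X.K₀ ω, X.W ω)) P :=
      (X.indep_static_days.comp measurable_swap measurable_id).symm
    exact ((indepFun_prodMk_of_indepFun hD X.measurable_K₀ X.measurable_W h1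
      X.indep_W_K₀.symm).comp measurable_swap measurable_id).symm
  have hg : Measurable fun x : ℝ × (ℕ → Bool × ℝ) => G.rule q S (G.pathLevel q S t x) (x.2 t) :=
    (G.measurable_rule q S).comp ((G.measurable_pathLevel q S t).prodMk
      ((measurable_pi_apply t).comp measurable_snd))
  have := h.comp measurable_id hg
  refine this.congr .rfl (.of_eq ?_)
  funext ω
  exact congrArg (fun k => G.rule q S k (X.day t ω)) (X.ruleLevel_eq_pathLevel t ω).symm

theorem Population.indepFun_ruleLevel_day (t : ℕ) :
    IndepFun (X.ruleLevel q S t) (X.day t) P := by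
  let past : Ω → (Finset.range t → Bool × ℝ) := fun ω s => X.day s ω
  have hpast : Measurable past := measurable_pi_lambda _ fun s => X.measurable_day s
  have h1 : IndepFun past (X.day t) P := by
    have := iIndepFun.indepFun_finset (f := X.day) (Finset.range t) {t} (by simp) X.indep_days
      X.measurable_day
    exact this.comp measurable_id (measurable_pi_apply ⟨t, Finset.mem_singleton_self t⟩)
  have h2 : IndepFun X.K₀ (fun ω => (past ω, X.day t ω)) P :=
    X.indep_static_days.comp measurable_snd
      (ψ := fun d : ℕ → Bool × ℝ => ((fun s : Finset.range t => d s), d t)) (by fun_prop)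
  have h3 := indepFun_prodMk_of_indepFun X.measurable_K₀ hpast (X.measurable_day t) h2 h1
  -- `extend` turns the days before `t` into a sequence of days, with arbitrary later days.
  let extend : (Finset.range t → Bool × ℝ) → ℕ → Bool × ℝ := fun d s =>
    if h : s ∈ Finset.range t then d ⟨s, h⟩ else (false, 0)
  have hext : Measurable extend := by
    refine measurable_pi_lambda _ fun s => ?_
    by_cases h : s ∈ Finset.range t
    · simp only [extend, h, dif_pos]
      exact measurable_pi_apply _
    · simp only [extend, h, dif_neg, not_false_eq_true]
      exact measurable_const
  have := h3.comp ((G.measurable_pathLevel q S t).comp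
    (measurable_fst.prodMk (hext.comp measurable_snd))) measurable_id
  refine this.congr (.of_eq ?_) .rfl
  funext ω
  rw [X.ruleLevel_eq_pathLevel]
  refine (G.pathLevel_congr q S _ fun s hs => ?_).symm
  simp [extend, past, hs]

theorem Population.map_ruleLevel (h : G.IsStationary q S μ₀) (t : ℕ) :
    P.map (X.ruleLevel q S t) = μ₀ := by
  induction t with
  | zero => exact X.law_K₀
  | succ t ih =>
    have hi := (indepFun_iff_map_prod_eq_prod_map_map (X.measurable_ruleLevel t).aemeasurable
      (X.measurable_day t).aemeasurable).1 (X.indepFun_ruleLevel_day (q := q) (S := S) t)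
    rw [ih, X.map_day] at hi
    conv_rhs => rw [← h.invariant, ← hi]
    rw [Measure.map_map (G.measurable_nextLevel q S)
      ((X.measurable_ruleLevel t).prodMk (X.measurable_day t))]
    rfl

theorem Population.ae_ruleLevel (h : G.IsStationary q S μ₀) (t : ℕ) {s : ℝ → Prop}
    (hs : ∀ᵐ k ∂μ₀, s k) : ∀ᵐ ω ∂P, s (X.ruleLevel q S t ω) := by
  rw [← X.map_ruleLevel h t] at hs
  exact ae_of_ae_map (X.measurable_ruleLevel t).aemeasurable hs

end

section

/-! ### Loads under the threshold rule -/

variable {G : Game} {q S : ℝ} {μ₀ : Measure ℝ} {Ω : Type*} [MeasurableSpace Ω] {P : Measure Ω}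

section Loads

variable (X : Population G μ₀ P)

theorem Population.aggregate_congr {a a' : Ω → Fin 3} (h : a =ᵐ[P] a') :
    X.aggregate a = X.aggregate a' := by
  have (r : Fin 3) : X.load a r = X.load a' r := by
    unfold Population.load
    congr 1
    refine setIntegral_congr_set ?_
    filter_upwards [h] with ω hω
    exact congrArg (· = r) hω
  simp [Population.aggregate, this]

/-- Weights that are independent of the decisions cancel from the loads. -/
theorem Population.load_eq_measureReal {a : Ω → Fin 3} (ha : Measurable a)
    (h : IndepFun X.W a P) (r : Fin 3) : X.load a r = P.real {ω | a ω = r} := by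
  have hms : MeasurableSet {ω | a ω = r} := ha (measurableSet_singleton r)
  have hφ : Measurable fun s : Fin 3 => if s = r then (1 : ℝ) else 0 := measurable_of_countable _
  have hi := (h.comp measurable_id hφ).integral_fun_mul_eq_mul_integral
    X.measurable_W.aestronglyMeasurable (hφ.comp ha).aestronglyMeasurable
  have h1 : (fun ω => (id ∘ X.W) ω * ((fun s : Fin 3 => if s = r then (1 : ℝ) else 0) ∘ a) ω) =
      {ω | a ω = r}.indicator X.W := by
    funext ω
    by_cases hω : a ω = r <;> simp [indicator, hω]
  have h2 : ((fun s : Fin 3 => if s = r then (1 : ℝ) else 0) ∘ a) =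
      {ω | a ω = r}.indicator 1 := by
    funext ω
    by_cases hω : a ω = r <;> simp [indicator, hω]
  rw [h1, h2, integral_indicator hms, integral_indicator_one hms] at hi
  rw [Population.load, hi]
  exact mul_div_cancel_left₀ _ X.integral_W_pos.ne'

variable [IsProbabilityMeasure P]

theorem Game.IsStationary.ae_nonneg (h : G.IsStationary q S μ₀) : ∀ᵐ k ∂μ₀, 0 ≤ k := by
  obtain ⟨E, h0, hE⟩ := h.support
  exact hE.mono h0

theorem Game.IsStationary.exists_bound (h : G.IsStationary q S μ₀) :
    ∃ B, ∀ᵐ k ∂μ₀, |k| ≤ B := by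
  obtain ⟨E, -, hE⟩ := h.support
  refine ⟨∑ k ∈ E, |k|, hE.mono fun k hk => ?_⟩
  exact Finset.single_le_sum (f := fun k => |k|) (fun _ _ => abs_nonneg _) hk

/-- Since the mean level is constant, the mean payment vanishes: strategy `2` is chosen `q` times as
often as strategy `1`, whatever the rest of the stationary law looks like. -/
theorem Population.aggregate_ruleDecision (h : G.IsStationary q S μ₀) (hq : 0 < q) (hS : 0 < S)
    (t : ℕ) : X.aggregate (X.ruleDecision q S t) = (G.Pgo / (1 + q), G.Pgo * q / (1 + q)) := by
  set a := X.ruleDecision q S t with ha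
  have ham : Measurable a := X.measurable_ruleDecision t
  have hms (r : Fin 3) : MeasurableSet {ω | a ω = r} := ham (measurableSet_singleton r)
  have hsum : P.real {ω | a ω = 1} + P.real {ω | a ω = 2} = G.Pgo := by
    rw [← X.law_participates t, ← measureReal_union _ (hms 2)]
    · congr 1
      ext ω
      have h0 : a ω = 0 ↔ X.participates t ω = false := Game.rule_eq_zero_iff
      simp only [mem_union, mem_ofPred_eq]
      rw [← Bool.not_eq_false, ← h0]
      generalize a ω = r
      fin_cases r <;> simp
    · refine Set.disjoint_left.2 fun ω h1 h2 => ?_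
      have h1 : a ω = 1 := h1
      have h2 : a ω = 2 := h2
      simp [h1] at h2
  obtain ⟨B, hB⟩ := h.exists_bound
  have hint (s : ℕ) : Integrable (X.ruleLevel q S s) P :=
    .of_bound (X.measurable_ruleLevel s).aestronglyMeasurable B (X.ae_ruleLevel h s hB)
  have hmean (s : ℕ) : ∫ ω, X.ruleLevel q S s ω ∂P = ∫ k, k ∂μ₀ := by
    have := integral_map (μ := P) (X.measurable_ruleLevel (q := q) (S := S) s).aemeasurable
      (f := fun k : ℝ => k) aestronglyMeasurable_id
    rw [X.map_ruleLevel h s] at this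
    exact this.symm
  have hpay : ∫ ω, payment (S * q, -S) (a ω) ∂P = 0 := by
    have h1 : (fun ω => payment (S * q, -S) (a ω)) =
        fun ω => X.ruleLevel q S t ω - X.ruleLevel q S (t + 1) ω := by
      funext ω
      simp [Population.ruleLevel, Game.nextLevel, ha, Population.ruleDecision]
    rw [h1, integral_sub (hint _) (hint _), hmean, hmean, sub_self]
  have hpay' : ∫ ω, payment (S * q, -S) (a ω) ∂P =
      S * q * P.real {ω | a ω = 1} - S * P.real {ω | a ω = 2} := by
    have h1 : (fun ω => payment (S * q, -S) (a ω)) =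
        fun ω => S * q * {ω | a ω = 1}.indicator 1 ω - S * {ω | a ω = 2}.indicator 1 ω := by
      funext ω
      simp only [indicator, mem_ofPred_eq, payment, Pi.one_apply]
      generalize a ω = r
      fin_cases r <;> simp
    rw [h1, integral_sub, integral_const_mul, integral_const_mul, integral_indicator_one (hms 1),
      integral_indicator_one (hms 2)]
    · exact ((integrable_const 1).indicator (hms 1)).const_mul _
    · exact ((integrable_const 1).indicator (hms 2)).const_mul _
  have hi := X.indepFun_W_ruleDecision (q := q) (S := S) t
  rw [Population.aggregate, X.load_eq_measureReal ham hi, X.load_eq_measureReal ham hi]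
  rw [hpay', mul_assoc, ← mul_sub, mul_eq_zero, or_iff_right hS.ne', sub_eq_zero] at hpay
  rw [← hpay] at hsum ⊢
  have h1 : P.real {ω | a ω = 1} = G.Pgo / (1 + q) := by
    rw [eq_div_iff (by positivity)]
    linarith
  rw [h1]
  congr 1
  ring

end Loads

/-! ### Equilibrium paths are the paths of the threshold rule -/

/-- Strategy `1` is strictly faster at the loads `G.Pgo / (1 + q)` and `G.Pgo * q / (1 + q)` under
which payments at the price ratio `q` balance. -/
def Game.BalancedFirstFaster (G : Game) (q : ℝ) : Prop :=
  G.l₁ (G.Pgo / (1 + q)) < G.l₂ (G.Pgo * q / (1 + q))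

variable {X : Population G μ₀ P}

theorem Population.IsNash.congr_level {p : ℝ × ℝ} {t : ℕ} {K K' : Ω → ℝ} {a : Ω → Fin 3}
    (h : X.IsNash p t K a) (hK : K =ᵐ[P] K') : X.IsNash p t K' a where
  measurable := h.measurable
  absent := h.absent
  bestResponse := by
    filter_upwards [h.bestResponse, hK] with ω h1 h2
    rwa [← h2]

variable [IsProbabilityMeasure P]

theorem Population.firstFaster_ruleDecision (h : G.IsStationary q S μ₀) (hq : 0 < q) (hS : 0 < S)
    (hl : G.BalancedFirstFaster q) (t : ℕ) : X.FirstFaster (X.ruleDecision q S t) := by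
  rw [Population.FirstFaster, X.aggregate_ruleDecision h hq hS]
  exact hl

theorem Population.isNash_ruleDecision (h : G.IsStationary q S μ₀) (hq : 0 < q) (hS : 0 < S)
    (hl : G.BalancedFirstFaster q) (t : ℕ) :
    X.IsNash (S * q, -S) t (X.ruleLevel q S t) (X.ruleDecision q S t) where
  measurable := X.measurable_ruleDecision t
  absent := .of_forall fun ω hp => Game.rule_eq_zero_iff.2 hp
  bestResponse := by
    have hfast := Population.firstFaster_ruleDecision (X := X) h hq hS hl t
    filter_upwards [X.ae_ruleLevel h t h.ae_nonneg, X.ae_U_nonneg t] with ω hk hu hp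
    have hrule : X.ruleDecision q S t ω = if S * q ≤ X.ruleLevel q S t ω ∧
        G.threshold q S (X.ruleLevel q S t ω) ≤ X.U t ω then 1 else 2 := by
      rw [Population.ruleDecision, Population.day, hp, Game.rule_of_nonneg hu]
    rw [hrule]
    split_ifs with hc
    · exact (Game.isBestResponse_one_iff hq hS hk hfast).2 hc
    · exact (Game.isBestResponse_two_iff hq hS hk hfast).2 fun h => by
        by_contra! h'
        exact hc ⟨h, h'.le⟩

/-- An equilibrium with `l₁ < l₂` is unique up to null sets: ties occur only if the urgency hits
the threshold, which takes finitely many values on the support of the levels. -/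
theorem Population.IsNash.ae_eq_ruleDecision (h : G.IsStationary q S μ₀) (hq : 0 < q) (hS : 0 < S)
    {t : ℕ} {a : Ω → Fin 3} (ha : X.IsNash (S * q, -S) t (X.ruleLevel q S t) a)
    (hfast : X.FirstFaster a) : a =ᵐ[P] X.ruleDecision q S t := by
  have := G.nullSingletonClass_urgencyLaw
  obtain ⟨E, -, hE⟩ := h.support
  have htie : ∀ᵐ ω ∂P, X.U t ω ∉ G.threshold q S '' E := by
    refine ae_of_ae_map (X.measurable_U t).aemeasurable (p := (· ∉ G.threshold q S '' E)) ?_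
    rw [X.law_U]
    exact measure_eq_zero_iff_ae_notMem.1 ((E.finite_toSet.image _).measure_zero _)
  filter_upwards [X.ae_ruleLevel h t h.ae_nonneg, X.ae_ruleLevel h t hE, X.ae_U_nonneg t,
    ha.absent, ha.bestResponse, htie] with ω hk hkE hu h0 hbr htie
  rcases hp : X.participates t ω
  · rw [h0 hp]
    exact (Game.rule_eq_zero_iff.2 hp).symm
  have hrule : X.ruleDecision q S t ω = if S * q ≤ X.ruleLevel q S t ω ∧
      G.threshold q S (X.ruleLevel q S t ω) ≤ X.U t ω then 1 else 2 := by
    rw [Population.ruleDecision, Population.day, hp, Game.rule_of_nonneg hu]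
  specialize hbr hp
  have hne : X.U t ω ≠ G.threshold q S (X.ruleLevel q S t ω) := fun he =>
    htie ⟨_, hkE, he.symm⟩
  have h1 := Game.isBestResponse_one_iff (u := X.U t ω) hq hS hk hfast
  have h2 := Game.isBestResponse_two_iff (u := X.U t ω) hq hS hk hfast
  have hcases : a ω = 1 ∨ a ω = 2 := by
    have := hbr.ne_zero
    omega
  rw [hrule]
  rcases hcases with hr | hr <;> rw [hr] at hbr ⊢
  · rw [if_pos (h1.1 hbr)]
  · rw [if_neg fun hc => hne (le_antisymm (h2.1 hbr hc.1) hc.2)]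

theorem Population.isEquilibriumPath_ruleDecision (h : G.IsStationary q S μ₀) (hq : 0 < q)
    (hS : 0 < S) (hl : G.BalancedFirstFaster q) :
    X.IsEquilibriumPath (S * q, -S) (X.ruleDecision q S) where
  isNash t := by
    rw [X.level_ruleDecision]
    exact Population.isNash_ruleDecision h hq hS hl t
  selection t _ := Population.firstFaster_ruleDecision h hq hS hl t

variable {A : ℕ → Ω → Fin 3}

/-- Every equilibrium path follows the threshold rule almost surely. -/
theorem Population.IsEquilibriumPath.level_ae_eq (hA : X.IsEquilibriumPath (S * q, -S) A)
    (h : G.IsStationary q S μ₀) (hq : 0 < q) (hS : 0 < S) (hl : G.BalancedFirstFaster q) (t : ℕ) :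
    X.level (S * q, -S) A t =ᵐ[P] X.ruleLevel q S t ∧ A t =ᵐ[P] X.ruleDecision q S t := by
  -- Equal levels on day `t` admit the threshold rule as an equilibrium with `l₁ < l₂`, so that the
  -- path has to select it.
  have step (t : ℕ) (ht : X.level (S * q, -S) A t =ᵐ[P] X.ruleLevel q S t) :
      A t =ᵐ[P] X.ruleDecision q S t :=
    ((hA.isNash t).congr_level ht).ae_eq_ruleDecision h hq hS (hA.selection t ⟨_,
      (Population.isNash_ruleDecision h hq hS hl t).congr_level ht.symm,
      Population.firstFaster_ruleDecision h hq hS hl t⟩)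
  induction t with
  | zero => exact ⟨.rfl, step 0 .rfl⟩
  | succ t ih =>
    have : X.level (S * q, -S) A (t + 1) =ᵐ[P] X.ruleLevel q S (t + 1) := by
      filter_upwards [ih.1, ih.2] with ω h1 h2
      simp only [Population.level, h1, h2]
      rfl
    exact ⟨this, step _ this⟩

theorem Population.IsEquilibriumPath.aggregate_eq (hA : X.IsEquilibriumPath (S * q, -S) A)
    (h : G.IsStationary q S μ₀) (hq : 0 < q) (hS : 0 < S) (hl : G.BalancedFirstFaster q) (t : ℕ) :
    X.aggregate (A t) = (G.Pgo / (1 + q), G.Pgo * q / (1 + q)) := by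
  rw [X.aggregate_congr (hA.level_ae_eq h hq hS hl t).2, X.aggregate_ruleDecision h hq hS]

theorem Population.IsEquilibriumPath.tendstoInDistribution_level [IsProbabilityMeasure μ₀]
    (hA : X.IsEquilibriumPath (S * q, -S) A)
    (h : G.IsStationary q S μ₀) (hq : 0 < q) (hS : 0 < S) (hl : G.BalancedFirstFaster q) :
    TendstoInDistribution (X.level (S * q, -S) A) atTop (fun k : ℝ => k) (fun _ => P) μ₀ where
  forall_aemeasurable t := ⟨_, X.measurable_ruleLevel t, (hA.level_ae_eq h hq hS hl t).1⟩
  tendsto := by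
    refine tendsto_const_nhds.congr fun t => Subtype.ext ?_
    change μ₀.map id = P.map _
    rw [Measure.map_id, Measure.map_congr (hA.level_ae_eq h hq hS hl t).1, X.map_ruleLevel h]

end

section

/-! ### Vanishing temporal inequity -/

theorem tendsto_sqrt_variance_zero {Ω : Type*} [MeasurableSpace Ω] {P : Measure Ω}
    [IsProbabilityMeasure P] {f : ℕ → Ω → ℝ} {B c : ℝ} (hf : ∀ t, Measurable (f t))
    (hB : ∀ t ω, |f t ω| ≤ B) (hlim : ∀ᵐ ω ∂P, Tendsto (fun t => f t ω) atTop (𝓝 c)) :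
    Tendsto (fun t => Real.sqrt (variance (f t) P)) atTop (𝓝 0) := by
  have hmain : Tendsto (fun t => ∫ ω, (f t ω - c) ^ 2 ∂P) atTop (𝓝 (∫ _, (0 : ℝ) ∂P)) := by
    refine tendsto_integral_of_dominated_convergence (fun _ => (B + |c|) ^ 2)
      (fun t => (((hf t).sub_const c).pow_const 2).aestronglyMeasurable) (integrable_const _)
      (fun t => .of_forall fun ω => ?_) ?_
    · rw [Real.norm_eq_abs, abs_pow]
      gcongr
      exact (abs_sub _ _).trans (by gcongr; exact hB t ω)
    · filter_upwards [hlim] with ω hω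
      simpa using (hω.sub_const c).pow 2
  have hvar : Tendsto (fun t => variance (f t) P) atTop (𝓝 0) := by
    refine squeeze_zero (fun t => variance_nonneg _ _) (fun t => ?_) (by simpa using hmain)
    rw [← variance_sub_const (hf t).aestronglyMeasurable c]
    exact variance_le_expectation_sq ((hf t).sub_const c).aestronglyMeasurable
  simpa using hvar.sqrt

section Counting

variable {Ω : Type*} {A : ℕ → Ω → Fin 3}

theorem participations_succ (A : ℕ → Ω → Fin 3) (t : ℕ) (ω : Ω) :
    participations A (t + 1) ω = participations A t ω + if A t ω ≠ 0 then 1 else 0 := by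
  simp only [participations, Finset.card_filter, Finset.sum_range_succ]

theorem firstChoices_succ (A : ℕ → Ω → Fin 3) (t : ℕ) (ω : Ω) :
    firstChoices A (t + 1) ω = firstChoices A t ω + if A t ω = 1 then 1 else 0 := by
  simp only [firstChoices, Finset.card_filter, Finset.sum_range_succ]

theorem firstChoices_le_participations (A : ℕ → Ω → Fin 3) (t : ℕ) (ω : Ω) :
    firstChoices A t ω ≤ participations A t ω :=
  Finset.card_le_card (Finset.monotone_filter_right _ fun s _ h => by simp [h])

theorem tendsto_participations {ω : Ω} (h : ∃ᶠ t in atTop, A t ω ≠ 0) :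
    Tendsto (fun t => participations A t ω) atTop atTop := by
  refine tendsto_atTop_atTop_of_monotone (monotone_nat_of_le_succ fun t => ?_) fun n => ?_
  · rw [participations_succ]
    exact Nat.le_add_right _ _
  · induction n with
    | zero => exact ⟨0, Nat.zero_le _⟩
    | succ n ih =>
      obtain ⟨t, ht⟩ := ih
      obtain ⟨s, hs, hne⟩ := frequently_atTop.1 h t
      refine ⟨s + 1, ?_⟩
      have hmono : participations A t ω ≤ participations A s ω :=
        Finset.card_le_card (Finset.filter_subset_filter _ (Finset.range_mono hs))
      rw [participations_succ, if_pos hne]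
      omega

/-- Latencies met under a constant aggregate; absent days contribute `0`. -/
theorem sum_latency_eq (G : Game) (w : ℝ × ℝ) (A : ℕ → Ω → Fin 3) (t : ℕ) (ω : Ω) :
    ∑ s ∈ Finset.range t, G.latency w (A s ω) = G.l₁ w.1 * firstChoices A t ω +
      (participations A t ω - firstChoices A t ω) * G.l₂ w.2 := by
  induction t with
  | zero => simp [firstChoices, participations]
  | succ t ih =>
    rw [Finset.sum_range_succ, ih, firstChoices_succ, participations_succ]
    generalize A t ω = r
    fin_cases r <;> simp [Game.latency] <;> ring

theorem abs_combination_le {a b x : ℝ} (h0 : 0 ≤ x) (h1 : x ≤ 1) :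
    |a * x + (1 - x) * b| ≤ |a| + |b| := by
  refine (abs_add_le _ _).trans ?_
  rw [abs_mul, abs_mul, abs_of_nonneg h0, abs_of_nonneg (by linarith : 0 ≤ 1 - x)]
  exact add_le_add (mul_le_of_le_one_right (abs_nonneg _) h1)
    (mul_le_of_le_one_left (abs_nonneg _) (by linarith))

theorem firstChoices_div_mem_Icc (A : ℕ → Ω → Fin 3) (t : ℕ) (ω : Ω) :
    (firstChoices A t ω : ℝ) / participations A t ω ∈ Icc (0 : ℝ) 1 :=
  ⟨by positivity, div_le_one_of_le₀ (by exact_mod_cast firstChoices_le_participations A t ω)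
    (by positivity)⟩

end Counting

variable {G : Game} {q S : ℝ} {μ₀ : Measure ℝ} {Ω : Type*} [MeasurableSpace Ω] {P : Measure Ω}
  {A : ℕ → Ω → Fin 3}

theorem measurable_participations (hA : ∀ t, Measurable (A t)) (t : ℕ) :
    Measurable (participations A t) := by
  induction t with
  | zero => exact measurable_const
  | succ t ih =>
    have hφ : Measurable fun r : Fin 3 => if r ≠ 0 then 1 else 0 := measurable_of_countable _
    rw [funext (participations_succ A t)]
    exact ih.add (hφ.comp (hA t))

theorem measurable_firstChoices (hA : ∀ t, Measurable (A t)) (t : ℕ) :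
    Measurable (firstChoices A t) := by
  induction t with
  | zero => exact measurable_const
  | succ t ih =>
    have hφ : Measurable fun r : Fin 3 => if r = 1 then 1 else 0 := measurable_of_countable _
    rw [funext (firstChoices_succ A t)]
    exact ih.add (hφ.comp (hA t))

/-- Payments determine how often each strategy has been chosen, in terms of the level. -/
theorem Population.level_eq (X : Population G μ₀ P) (A : ℕ → Ω → Fin 3) (t : ℕ) (ω : Ω) :
    X.level (S * q, -S) A t ω =
      X.K₀ ω - S * (1 + q) * firstChoices A t ω + S * participations A t ω := by
  induction t with
  | zero => simp [Population.level, firstChoices, participations]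
  | succ t ih =>
    simp only [Population.level, ih, firstChoices_succ, participations_succ]
    generalize A t ω = r
    fin_cases r <;> simp [payment] <;> ring

variable {X : Population G μ₀ P} [IsProbabilityMeasure P]

/-- Almost every player participates infinitely often, by the second Borel-Cantelli lemma. -/
theorem Population.ae_frequently_participates (X : Population G μ₀ P) :
    ∀ᵐ ω ∂P, ∃ᶠ t in atTop, X.participates t ω = true := by
  let s (t : ℕ) : Set Ω := {ω | X.participates t ω = true}
  have hs (t : ℕ) : MeasurableSet (s t) := X.measurable_participates t (measurableSet_singleton _)
  have hind : iIndepSet s P := by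
    rw [iIndepSet_iff_meas_biInter hs]
    intro F
    exact iIndepFun_iff_measure_inter_preimage_eq_mul.1 X.indep_days F
      (sets := fun _ => Prod.fst ⁻¹' {true}) fun _ _ =>
        measurable_fst (measurableSet_singleton true)
  have hval (t : ℕ) : P (s t) = ENNReal.ofReal G.Pgo := by
    rw [← X.law_participates t, ofReal_measureReal]
  have h1 := measure_limsup_eq_one hs hind (by
    simp_rw [hval]
    exact ENNReal.tsum_const_eq_top_of_ne_zero (by simpa using G.Pgo_pos))
  have hm : MeasurableSet (limsup s atTop) := .measurableSet_limsup hs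
  filter_upwards [(prob_compl_eq_zero_iff hm).2 h1 |> measure_eq_zero_iff_ae_notMem.1] with ω hω
  rw [notMem_compl_iff, mem_limsup_iff_frequently_mem] at hω
  exact hω

theorem Population.IsEquilibriumPath.ae_tendsto_participations {p : ℝ × ℝ}
    (hA : X.IsEquilibriumPath p A) :
    ∀ᵐ ω ∂P, Tendsto (fun t => participations A t ω) atTop atTop := by
  have hbr := ae_all_iff.2 fun t => (hA.isNash t).bestResponse
  filter_upwards [hbr, X.ae_frequently_participates] with ω hω hf
  exact tendsto_participations (hf.mono fun t ht => (hω t ht).ne_zero)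

/-- Since levels stay bounded, payments balance in the long run for every single player. -/
theorem Population.IsEquilibriumPath.ae_tendsto_ratio (hA : X.IsEquilibriumPath (S * q, -S) A)
    (h : G.IsStationary q S μ₀) (hq : 0 < q) (hS : 0 < S) (hl : G.BalancedFirstFaster q) :
    ∀ᵐ ω ∂P, Tendsto (fun t => (firstChoices A t ω : ℝ) / participations A t ω) atTop
      (𝓝 (1 / (1 + q))) := by
  obtain ⟨B, hB⟩ := h.exists_bound
  have hlev : ∀ᵐ ω ∂P, ∀ t, |X.level (S * q, -S) A t ω| ≤ B := ae_all_iff.2 fun t => by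
    filter_upwards [(hA.level_ae_eq h hq hS hl t).1, X.ae_ruleLevel h t hB] with ω h1 h2
    rwa [h1]
  filter_upwards [hlev, hA.ae_tendsto_participations] with ω hω hN
  have hN' : Tendsto (fun t => (participations A t ω : ℝ)) atTop atTop :=
    tendsto_natCast_atTop_atTop.comp hN
  have hz : Tendsto (fun t => (X.K₀ ω - X.level (S * q, -S) A t ω) / participations A t ω) atTop
      (𝓝 0) := by
    refine squeeze_zero_norm (fun t => ?_) (hN'.const_div_atTop (2 * B))
    rw [norm_div, Real.norm_eq_abs, Real.norm_natCast]
    gcongr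
    refine (abs_sub _ _).trans ?_
    have := hω 0
    have := hω t
    simp only [Population.level] at *
    linarith
  have hlim := (hz.div_const (S * (1 + q))).const_add (1 / (1 + q))
  rw [zero_div, add_zero] at hlim
  refine hlim.congr' ?_
  filter_upwards [hN.eventually_gt_atTop 0] with t ht
  have ht : (0 : ℝ) < participations A t ω := by exact_mod_cast ht
  rw [X.level_eq]
  field_simp
  ring

/-- The aggregate never changes along an equilibrium path, so both averages of latencies agree
once a player has participated. Before that, `timeAvgLatency` is `0` and `avgLatency` is the latency
of strategy `2`, both through division by `0`. -/
theorem Population.IsEquilibriumPath.timeAvgLatency_eq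
    (hA : X.IsEquilibriumPath (S * q, -S) A)
    (h : G.IsStationary q S μ₀) (hq : 0 < q) (hS : 0 < S) (hl : G.BalancedFirstFaster q)
    (t : ℕ) (ω : Ω) : X.timeAvgLatency A t ω =
      if participations A t ω = 0 then 0 else X.avgLatency A t ω := by
  simp only [Population.timeAvgLatency, Population.avgLatency, hA.aggregate_eq h hq hS hl,
    sum_latency_eq]
  split_ifs with h0
  · simp [h0]
  · have : (participations A t ω : ℝ) ≠ 0 := by exact_mod_cast h0
    field_simp

theorem Population.IsEquilibriumPath.avgLatency_limit (hA : X.IsEquilibriumPath (S * q, -S) A)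
    (h : G.IsStationary q S μ₀) (hq : 0 < q) (hS : 0 < S) (hl : G.BalancedFirstFaster q) :
    (∀ t, Measurable (X.avgLatency A t)) ∧ (∃ B, ∀ t ω, |X.avgLatency A t ω| ≤ B) ∧
      ∃ c, ∀ᵐ ω ∂P, Tendsto (fun t => X.avgLatency A t ω) atTop (𝓝 c) := by
  have hm (t : ℕ) := (hA.isNash t).measurable
  have hr (t : ℕ) : Measurable fun ω => (firstChoices A t ω : ℝ) / participations A t ω :=
    (measurable_from_nat.comp (measurable_firstChoices hm t)).div
      (measurable_from_nat.comp (measurable_participations hm t))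
  unfold Population.avgLatency
  simp only [hA.aggregate_eq h hq hS hl]
  refine ⟨fun t => ?_, ⟨_, fun t ω => abs_combination_le (firstChoices_div_mem_Icc A t ω).1
    (firstChoices_div_mem_Icc A t ω).2⟩,
    G.l₁ (G.Pgo / (1 + q)) * (1 / (1 + q)) +
      (1 - 1 / (1 + q)) * G.l₂ (G.Pgo * q / (1 + q)), ?_⟩
  · exact ((hr t).const_mul _).add (((hr t).const_sub 1).mul_const _)
  · filter_upwards [hA.ae_tendsto_ratio h hq hS hl] with ω hω
    exact (hω.const_mul _).add ((hω.const_sub 1).mul_const _)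

theorem Population.IsEquilibriumPath.temporal_inequity_vanishes
    (hA : X.IsEquilibriumPath (S * q, -S) A)
    (h : G.IsStationary q S μ₀) (hq : 0 < q) (hS : 0 < S) (hl : G.BalancedFirstFaster q) :
    (∀ t, MemLp (X.avgLatency A t) 2 P) ∧
      Tendsto (fun t => Real.sqrt (variance (X.avgLatency A t) P)) atTop (𝓝 0) ∧
      (∀ t, MemLp (X.timeAvgLatency A t) 2 P) ∧
      Tendsto (fun t => Real.sqrt (variance (X.timeAvgLatency A t) P)) atTop (𝓝 0) := by
  obtain ⟨hm, ⟨B, hB⟩, c, hc⟩ := hA.avgLatency_limit h hq hS hl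
  have heq := hA.timeAvgLatency_eq h hq hS hl
  have hm' (t : ℕ) : Measurable (X.timeAvgLatency A t) := by
    rw [funext (heq t)]
    exact Measurable.ite (measurable_participations (fun t => (hA.isNash t).measurable) t
      (measurableSet_singleton 0)) measurable_const (hm t)
  have hB' (t : ℕ) (ω : Ω) : |X.timeAvgLatency A t ω| ≤ B := by
    rw [heq]
    split_ifs
    · rw [abs_zero]
      exact (abs_nonneg _).trans (hB t ω)
    · exact hB t ω
  have hc' : ∀ᵐ ω ∂P, Tendsto (fun t => X.timeAvgLatency A t ω) atTop (𝓝 c) := by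
    filter_upwards [hc, hA.ae_tendsto_participations] with ω hω hN
    refine hω.congr' ?_
    filter_upwards [hN.eventually_gt_atTop 0] with t ht
    rw [heq, if_neg ht.ne']
  exact ⟨fun t => .of_bound (hm t).aestronglyMeasurable B (.of_forall (hB t)),
    tendsto_sqrt_variance_zero hm hB hc,
    fun t => .of_bound (hm' t).aestronglyMeasurable B (.of_forall (hB' t)),
    tendsto_sqrt_variance_zero hm' hB' hc'⟩

/-! ### The rational price ratio -/

theorem exists_rat_eq {δ x : ℝ} (hδ : 0 < δ) (hx : 0 < x) {q : ℕ → ℚ}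
    (hq : IsRationalFamily δ q) : ∃ j, rat δ q x = q j ∧ 0 < q j ∧ |(q j : ℝ) - x| < δ := by
  have hceil : 0 < ⌈x / δ⌉₊ := Nat.ceil_pos.2 (by positivity)
  have hmem (j : ℕ) : x ∈ bracket δ j ↔ j + 1 = ⌈x / δ⌉₊ := by
    rw [eq_comm, Nat.ceil_eq_iff (Nat.succ_ne_zero j)]
    simp only [bracket, mem_Ioc, lt_div_iff₀ hδ, div_le_iff₀ hδ]
    simp
  obtain ⟨j, hj⟩ : ∃ j, j + 1 = ⌈x / δ⌉₊ := ⟨⌈x / δ⌉₊ - 1, by omega⟩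
  refine ⟨j, ?_, (hq j).1, (hq j).2 x ((hmem j).2 hj)⟩
  rw [rat, tsum_eq_single j fun i hi => ?_]
  · exact indicator_of_mem ((hmem j).2 hj) _
  · refine indicator_of_notMem (fun h => hi ?_) _
    have := (hmem i).1 h
    omega

theorem Game.IsSystemOptimum.balanced_eq {wopt : ℝ × ℝ} (h : G.IsSystemOptimum wopt)
    (hw₁ : 0 < wopt.1) (hw₂ : 0 < wopt.2) :
    1 + wopt.2 / wopt.1 = G.Pgo / wopt.1 ∧ G.Pgo / (1 + wopt.2 / wopt.1) = wopt.1 ∧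
      G.Pgo * (wopt.2 / wopt.1) / (1 + wopt.2 / wopt.1) = wopt.2 := by
  obtain ⟨-, -, hs⟩ := h.1
  have := G.Pgo_pos
  have h1 : 1 + wopt.2 / wopt.1 = G.Pgo / wopt.1 := by
    rw [← hs]
    field_simp
  refine ⟨h1, ?_, ?_⟩ <;> rw [h1] <;> field_simp

/-- Close to the ratio of the optimal loads, balanced payments keep strategy `1` faster. -/
theorem Game.IsSystemOptimum.exists_balancedFirstFaster {wopt : ℝ × ℝ}
    (h : G.IsSystemOptimum wopt) (hw₁ : 0 < wopt.1) (hw₂ : 0 < wopt.2)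
    (hl : G.l₁ wopt.1 < G.l₂ wopt.2) :
    ∃ δ₀ > 0, ∀ q : ℝ, |q - wopt.2 / wopt.1| < δ₀ → G.BalancedFirstFaster q := by
  obtain ⟨-, e1, e2⟩ := h.balanced_eq hw₁ hw₂
  obtain ⟨-, -, hs⟩ := h.1
  set x := wopt.2 / wopt.1
  have hx : 1 + x ≠ 0 := by positivity
  have c1 : ContinuousAt (fun q : ℝ => G.l₁ (G.Pgo / (1 + q))) x := by
    refine ContinuousAt.comp (f := fun q : ℝ => G.Pgo / (1 + q)) (g := G.l₁) ?_
      (by fun_prop (disch := exact hx))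
    rw [e1]
    exact G.continuousOn_l₁.continuousAt (Icc_mem_nhds hw₁ (by linarith))
  have c2 : ContinuousAt (fun q : ℝ => G.l₂ (G.Pgo * q / (1 + q))) x := by
    refine ContinuousAt.comp (f := fun q : ℝ => G.Pgo * q / (1 + q)) (g := G.l₂) ?_
      (by fun_prop (disch := exact hx))
    rw [e2]
    exact G.continuousOn_l₂.continuousAt (Icc_mem_nhds hw₂ (by linarith))
  have hev : ∀ᶠ q in 𝓝 x, G.l₁ (G.Pgo / (1 + q)) < G.l₂ (G.Pgo * q / (1 + q)) :=
    c1.eventually_lt c2 (by rwa [e1, e2])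
  obtain ⟨δ₀, h0, hδ⟩ := Metric.eventually_nhds_iff.1 hev
  exact ⟨δ₀, h0, fun q hq => hδ hq⟩

/-- The balanced loads for a price ratio `q` are optimal up to an error of first order in the
distance from `q` to the ratio of the optimal loads. -/
theorem Game.IsSystemOptimum.cost_ratio_le {wopt : ℝ × ℝ} (h : G.IsSystemOptimum wopt)
    (hw₁ : 0 < wopt.1) (hw₂ : 0 < wopt.2) (hC : 0 < G.C wopt) {LC : ℝ≥0}
    (hLC : LipschitzOnWith LC G.C G.feasible) {δ : ℝ} (hδ : δ < G.Pgo / wopt.1) (hq : 0 < q)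
    (hqδ : |q - wopt.2 / wopt.1| < δ) :
    G.C (G.Pgo / (1 + q), G.Pgo * q / (1 + q)) / G.C wopt ≤
      1 + LC / G.C wopt * (δ * wopt.1 / (G.Pgo / wopt.1 - δ)) := by
  obtain ⟨e0, e1, e2⟩ := h.balanced_eq hw₁ hw₂
  obtain ⟨-, -, hs⟩ := h.1
  have hP := G.Pgo_pos
  have hfeas : (G.Pgo / (1 + q), G.Pgo * q / (1 + q)) ∈ G.feasible := by
    refine ⟨by positivity, by positivity, ?_⟩
    change G.Pgo / (1 + q) + G.Pgo * q / (1 + q) = G.Pgo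
    field_simp
  have hq1 : G.Pgo / wopt.1 - δ ≤ 1 + q := by
    rw [← e0]
    linarith [(abs_lt.1 hqδ).1]
  have hd : |G.Pgo / (1 + q) - wopt.1| ≤ δ * wopt.1 / (G.Pgo / wopt.1 - δ) := by
    have : G.Pgo / (1 + q) - wopt.1 = -((q - wopt.2 / wopt.1) * wopt.1 / (1 + q)) := by
      rw [← hs]
      field_simp
      ring
    rw [this, abs_neg, abs_div, abs_mul, abs_of_pos hw₁, abs_of_pos (by linarith : 0 < 1 + q)]
    have : 0 < G.Pgo / wopt.1 - δ := by linarith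
    have := (abs_nonneg _).trans hqδ.le
    gcongr
  have hd2 : |G.Pgo * q / (1 + q) - wopt.2| = |G.Pgo / (1 + q) - wopt.1| := by
    -- Both pairs of loads sum to `G.Pgo`, so the two deviations are opposite.
    rw [← abs_neg]
    congr 1
    rw [← hs]
    field_simp
    ring
  have hdist := hLC.dist_le_mul _ hfeas _ h.1
  rw [Prod.dist_eq, Real.dist_eq, Real.dist_eq, Real.dist_eq, hd2, max_self] at hdist
  have hcost : G.C (G.Pgo / (1 + q), G.Pgo * q / (1 + q)) - G.C wopt ≤
      LC * (δ * wopt.1 / (G.Pgo / wopt.1 - δ)) :=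
    (le_abs_self _).trans (hdist.trans (by gcongr))
  rw [div_le_iff₀ hC, add_mul, one_mul, mul_right_comm, div_mul_cancel₀ _ hC.ne']
  linarith

end

end ACGame

theorem mainTheorem2 (G : ACGame.Game) (wopt : ℝ × ℝ) (hopt : G.IsSystemOptimum wopt)
    (hw₁ : 0 < wopt.1) (hw₂ : 0 < wopt.2) (hl : G.l₁ wopt.1 < G.l₂ wopt.2)
    (hC : 0 < G.C wopt) (LC : ℝ≥0) (hLC : LipschitzOnWith LC G.C G.feasible) :
    ∃ δ₀ : ℝ, 0 < δ₀ ∧ ∀ δ : ℝ, 0 < δ → δ < δ₀ →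
      ∀ q : ℕ → ℚ, ACGame.IsRationalFamily δ q → ∀ S : ℝ, 0 < S →
      ∀ p : ℝ × ℝ, p = (S * ACGame.rat δ q (wopt.2 / wopt.1), -S) →
      ∃ μ₀ : Measure ℝ, IsProbabilityMeasure μ₀ ∧ (∀ᵐ k ∂μ₀, 0 ≤ k) ∧
        ∀ (Ω : Type*) [MeasurableSpace Ω] (P : Measure Ω) [IsProbabilityMeasure P]
          (X : ACGame.Population G μ₀ P),
          (∃ A : ℕ → Ω → Fin 3, X.IsEquilibriumPath p A) ∧
          ∀ A : ℕ → Ω → Fin 3, X.IsEquilibriumPath p A →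
            (∃ (μ : Measure ℝ) (_ : IsProbabilityMeasure μ),
              TendstoInDistribution (X.level p A) atTop (fun k : ℝ => k) (fun _ => P) μ) ∧
            (∃ ρ : ℝ, Tendsto (X.priceOfAnarchy wopt A) atTop (𝓝 ρ) ∧
              ρ ≤ 1 + LC / G.C wopt * (δ * wopt.1 / (G.Pgo / wopt.1 - δ))) ∧
            (∀ t, MemLp (X.avgLatency A t) 2 P) ∧
            Tendsto (fun t => Real.sqrt (variance (X.avgLatency A t) P)) atTop (𝓝 0) ∧
            (∀ t, MemLp (X.timeAvgLatency A t) 2 P) ∧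
            Tendsto (fun t => Real.sqrt (variance (X.timeAvgLatency A t) P)) atTop (𝓝 0) := by
  obtain ⟨δ₁, hδ₁, hfast⟩ := hopt.exists_balancedFirstFaster hw₁ hw₂ hl
  refine ⟨min δ₁ (G.Pgo / wopt.1), lt_min hδ₁ (div_pos G.Pgo_pos hw₁), ?_⟩
  rintro δ hδ hlt q hq S hS p rfl
  obtain ⟨j, hrat, hpos, hclose⟩ := ACGame.exists_rat_eq hδ (div_pos hw₂ hw₁) hq
  have hposR : (0 : ℝ) < q j := by exact_mod_cast hpos
  have hfast := hfast _ (hclose.trans (hlt.trans_le (min_le_left _ _)))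
  obtain ⟨μ₀, hprob, hstat⟩ := G.exists_isStationary (q j) hpos hS
  rw [hrat]
  refine ⟨μ₀, hprob, hstat.ae_nonneg, fun Ω _ P _ X =>
    ⟨⟨_, ACGame.Population.isEquilibriumPath_ruleDecision hstat hposR hS hfast⟩, fun A hA =>
    ⟨⟨μ₀, hprob, hA.tendstoInDistribution_level hstat hposR hS hfast⟩, ⟨_, ?_,
      hopt.cost_ratio_le hw₁ hw₂ hC hLC (hlt.trans_le (min_le_right _ _)) hposR hclose⟩,
      hA.temporal_inequity_vanishes hstat hposR hS hfast⟩⟩⟩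
  refine tendsto_const_nhds.congr fun t => ?_
  rw [ACGame.Population.priceOfAnarchy, hA.aggregate_eq hstat hposR hS hfast]
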